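/- Let $K$ and $L$ be finite abstract simplicial complexes with vertex sets $V(K)$ and $V(L)$ (every vertex is a simplex). A simplicial map is called non-degenerated if it is injective on every simplex. The cell complex $Hom(K,L)$ has its cells indexed by the functions $\eta : V(K)\to 2^{V(L)}\setminus\{\emptyset\}$ such that (1) $\eta(u)\cap\eta(v)=\emptyset$ whenever $u\neq v$ and $\{u,v\}\in K$, and (2) for each simplex $\sigma\in K$ the join $\ast_{v\in\sigma}\,\eta(v)$ of the sets $\eta(v)$, viewed as $0$-dimensional complexes, is a subcomplex of $L$. The cell of $\eta$ is $c_\eta=\prod_{v\in V(K)}\Delta^{\eta(v)}$, and $Hom(K,L)\subset\prod_{v\in V(K)}\Delta^{V(L)}$ is the union of these cells with the subspace topology, where $\Delta^S$ denotes the geometric simplex spanned by $S$. A non-degenerated simplicial map $f:K\to K'$ induces a continuous map $\widehat f: Hom(K',L)\to Hom(K,L)$, $(x_{v'})_{v'\in V(K')}\mapsto (x_{f(v)})_{v\in V(K)}$, which sends $c_\eta$ into $c_{\eta\circ f}$. For $k\ge 0$ and $k$-dimensional simplices $\sigma_0,\sigma_1$ of $K$ which share a common $(k-1)$-dimensional face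 (that is, $k$ common vertices), the perspectivity $\overrightarrow{\sigma_0\sigma_1}:\sigma_0\to\sigma_1$ is the unique non-degenerated simplicial map which fixes this face pointwise; for $\sigma_0=\sigma_1$ it is the identity. A projectivity is a composition of perspectivities along a path $\sigma_0,\sigma_1,\dots,\sigma_n$ of $k$-simplices of $K$ in which consecutive simplices share a common $(k-1)$-dimensional face. The $k$-simplices of $K$ and the projectivities between them form a groupoid, and $\Pi(K,\sigma)$, the group of projectivities, is the group of all projectivities from $\sigma$ to itself. Corollary 4.9. Let $\sigma$ be a $k$-dimensional simplex of $K$ (regarded as the complex of all its faces), let $\alpha:\sigma\to K$ be the embedding, and let $\tau\in\Pi(K,\sigma)$. Then the maps $\widehat\alpha$ and $\widehat\tau\circ\widehat\alpha$ from $Hom(K,L)$ to $Hom(\sigma,L)$ are homotopic: $$\widehat\alpha\;\simeq\;\widehat\tau\circ\widehat\alpha .$$ -/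

import Mathlib

/-!
Finite abstract simplicial complexes are Mathlib's `AbstractSimplicialComplex V` (vertex set `V`,
faces are nonempty finite subsets of `V`, every singleton is a face) over a finite type `V`.
-/

namespace SimplicialHom

open CategoryTheory

universe u v w

/-! ### Non-degenerated simplicial maps -/

/-- A non-degenerated simplicial map `K → K'`: a vertex map which sends simplices to simplices and
is injective on every simplex. -/
@[ext]
structure NondegMap {V : Type u} {V' : Type v} [DecidableEq V']
    (K : AbstractSimplicialComplex V) (K' : AbstractSimplicialComplex V') where
  toFun : V → V'
  image_mem : ∀ s ∈ K, s.image toFun ∈ K'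
  injOn : ∀ s ∈ K, Set.InjOn toFun (s : Set V)

/-- The identity map. -/
def NondegMap.id {V : Type u} [DecidableEq V] (K : AbstractSimplicialComplex V) :
    NondegMap K K where
  toFun := fun x => x
  image_mem := fun s hs => by simpa using hs
  injOn := fun _ _ _ _ _ _ h => h

/-- The composition `g ∘ f`. -/
def NondegMap.comp {V : Type u} {V' : Type v} {V'' : Type w} [DecidableEq V'] [DecidableEq V'']
    {K : AbstractSimplicialComplex V} {K' : AbstractSimplicialComplex V'}
    {K'' : AbstractSimplicialComplex V''} (g : NondegMap K' K'') (f : NondegMap K K') :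
    NondegMap K K'' where
  toFun := fun x => g.toFun (f.toFun x)
  image_mem := fun s hs => by
    have h := g.image_mem _ (f.image_mem s hs)
    rw [Finset.image_image] at h
    exact h
  injOn := fun s hs x hx y hy h => by
    refine f.injOn s hs hx hy (g.injOn _ (f.image_mem s hs) ?_ ?_ h)
    · exact Finset.mem_coe.2 (Finset.mem_image_of_mem _ hx)
    · exact Finset.mem_coe.2 (Finset.mem_image_of_mem _ hy)

/-! ### The cell complex `Hom(K, L)` -/

/-- The join `∗_{v ∈ σ} η v` of the sets `η v`, seen as `0`-dimensional complexes, inside the full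
simplex on `W`: its faces are the nonempty finite subsets of `⋃_{v ∈ σ} η v` with at most one
element in each `η v`.  (It is used for pairwise disjoint `η v`.) -/
def pointJoin {V : Type u} {W : Type v} (σ : Finset V) (η : V → Finset W) :
    PreAbstractSimplicialComplex W where
  faces := {s | s.Nonempty ∧ (∀ x ∈ s, ∃ v ∈ σ, x ∈ η v) ∧
    ∀ v ∈ σ, ∀ x ∈ s, ∀ y ∈ s, x ∈ η v → y ∈ η v → x = y}
  isRelLowerSet_faces := fun _ h =>
    ⟨h.1, fun _ hts ht => ⟨ht, fun x hx => h.2.1 x (hts hx),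
      fun v hv x hx y hy => h.2.2 v hv x (hts hx) y (hts hy)⟩⟩

/-- The functions `η : V(K) → 2^{V(L)} ∖ {∅}` which index the cells of `Hom(K, L)`. -/
structure IsCell {V : Type u} {W : Type v} [DecidableEq V] (K : AbstractSimplicialComplex V)
    (L : AbstractSimplicialComplex W) (η : V → Finset W) : Prop where
  nonempty : ∀ v, (η v).Nonempty
  disjoint : ∀ u v, u ≠ v → ({u, v} : Finset V) ∈ K → Disjoint (η u) (η v)
  join_le : ∀ σ ∈ K, pointJoin σ η ≤ L.toPreAbstractSimplicialComplex

/-- The closed cell `c_η = ∏_{v ∈ V} Δ^{η v}` in `∏_{v ∈ V} Δ^W`, where `Δ^S` is the face of the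
geometric simplex `Δ^W` spanned by `S`. -/
def cell {V : Type u} {W : Type v} [Fintype W] (η : V → Finset W) :
    Set (V → stdSimplex ℝ W) :=
  {x | ∀ v, ∀ a, x v a ≠ 0 → a ∈ η v}

/-- The space `Hom(K, L)`: the union of the cells `c_η` in `∏_{v ∈ V(K)} Δ^{V(L)}`, with the
subspace topology. -/
abbrev HomComplex {V : Type u} {W : Type v} [DecidableEq V] [Fintype W]
    (K : AbstractSimplicialComplex V) (L : AbstractSimplicialComplex W) : Type (max u v) :=
  {x : V → stdSimplex ℝ W // ∃ η : V → Finset W, IsCell K L η ∧ x ∈ cell η}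

/-- If `η` indexes a cell of `Hom(K', L)`, then `η ∘ f` indexes a cell of `Hom(K, L)`. -/
theorem IsCell.comp {V : Type u} {V' : Type v} {W : Type w} [DecidableEq V] [DecidableEq V']
    {K : AbstractSimplicialComplex V} {K' : AbstractSimplicialComplex V'}
    {L : AbstractSimplicialComplex W} {η : V' → Finset W} (h : IsCell K' L η)
    (f : NondegMap K K') : IsCell K L (fun v => η (f.toFun v)) where
  nonempty := fun v => h.nonempty _
  disjoint := fun u v huv huvK => by
    refine h.disjoint _ _ ?_ ?_
    · intro he
      exact huv (f.injOn _ huvK (by simp) (by simp) he)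
    · have := f.image_mem _ huvK
      simpa [Finset.image_insert] using this
  join_le := fun σ hσ s hs => by
    refine h.join_le _ (f.image_mem σ hσ) ?_
    obtain ⟨h1, h2, h3⟩ := hs
    refine ⟨h1, ?_, ?_⟩
    · intro x hx
      obtain ⟨v, hv, hxv⟩ := h2 x hx
      exact ⟨f.toFun v, Finset.mem_image_of_mem _ hv, hxv⟩
    · intro v' hv' x hx y hy hxv hyv
      obtain ⟨v, hv, rfl⟩ := Finset.mem_image.1 hv'
      exact h3 v hv x hx y hy hxv hyv

/-- The continuous map `Hom(K', L) → Hom(K, L)` associated with a non-degenerated simplicial map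
`f : K → K'`; it sends the cell of `η` to the cell of `η ∘ f`. -/
def NondegMap.hat {V : Type u} {V' : Type v} {W : Type w} [DecidableEq V] [DecidableEq V']
    [Fintype W] {K : AbstractSimplicialComplex V} {K' : AbstractSimplicialComplex V'}
    (f : NondegMap K K') (L : AbstractSimplicialComplex W) :
    C(HomComplex K' L, HomComplex K L) where
  toFun := fun x => ⟨fun v => x.1 (f.toFun v), by
    obtain ⟨η, hη, hx⟩ := x.2
    exact ⟨fun v => η (f.toFun v), hη.comp f, fun v => hx (f.toFun v)⟩⟩
  continuous_toFun := Continuous.subtype_mk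
    (continuous_pi fun v => (continuous_apply (f.toFun v)).comp
      (continuous_subtype_val (p := fun x : V' → stdSimplex ℝ W =>
        ∃ η : V' → Finset W, IsCell K' L η ∧ x ∈ cell η))) _

/-! ### Simplices and projectivities -/

/-- The `k`-dimensional simplices of `K`. -/
structure KSimplex {V : Type u} (K : AbstractSimplicialComplex V) (k : ℕ) where
  verts : Finset V
  mem : verts ∈ K
  card_eq : verts.card = k + 1

/-- A simplex of `K`, as a simplicial complex: all nonempty subsets of its vertex set. -/
abbrev KSimplex.toComplex {V : Type u} {K : AbstractSimplicialComplex V} {k : ℕ}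
    (σ : KSimplex K k) : AbstractSimplicialComplex {x // x ∈ σ.verts} := ⊤

/-- The embedding `α : σ → K`. -/
def KSimplex.incl {V : Type u} [DecidableEq V] {K : AbstractSimplicialComplex V} {k : ℕ}
    (σ : KSimplex K k) : NondegMap σ.toComplex K where
  toFun := fun x => x.1
  image_mem := fun s hs => by
    refine (K.isRelLowerSet_faces σ.mem).2 ?_ ?_
    · intro x hx
      obtain ⟨y, -, rfl⟩ := Finset.mem_image.1 hx
      exact y.2
    · exact Finset.Nonempty.image hs _
  injOn := fun _ _ _ _ _ _ h => Subtype.ext h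

/-- `f : σ₀ → σ₁` is a perspectivity: the two `k`-simplices share a common `(k-1)`-dimensional face
(`k` common vertices) which the non-degenerated simplicial map `f` fixes pointwise.  Such an `f` is
determined by `σ₀` and `σ₁`; for `σ₀ = σ₁` it is the identity. -/
def IsPerspectivity {V : Type u} [DecidableEq V] {K : AbstractSimplicialComplex V} {k : ℕ}
    (σ₀ σ₁ : KSimplex K k) (f : NondegMap σ₀.toComplex σ₁.toComplex) : Prop :=
  ∃ ρ : Finset V, ρ ⊆ σ₀.verts ∧ ρ ⊆ σ₁.verts ∧ ρ.card = k ∧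
    ∀ x : {x // x ∈ σ₀.verts}, x.1 ∈ ρ → (f.toFun x).1 = x.1

/-- `f : σ₀ → σ₁` is a projectivity: the composition of the perspectivities along a path
`σ₀, …, σₙ` of `k`-simplices of `K`. -/
inductive IsProjectivity {V : Type u} [DecidableEq V] {K : AbstractSimplicialComplex V} {k : ℕ} :
    (σ₀ σ₁ : KSimplex K k) → NondegMap σ₀.toComplex σ₁.toComplex → Prop
  | id (σ : KSimplex K k) : IsProjectivity σ σ (NondegMap.id σ.toComplex)
  | step {σ₀ σ₁ σ₂ : KSimplex K k} {f : NondegMap σ₀.toComplex σ₁.toComplex}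
      {p : NondegMap σ₁.toComplex σ₂.toComplex} (hf : IsProjectivity σ₀ σ₁ f)
      (hp : IsPerspectivity σ₁ σ₂ p) : IsProjectivity σ₀ σ₂ (p.comp f)

theorem IsProjectivity.comp {V : Type u} [DecidableEq V] {K : AbstractSimplicialComplex V} {k : ℕ}
    {σ₀ σ₁ σ₂ : KSimplex K k} {f : NondegMap σ₀.toComplex σ₁.toComplex}
    {g : NondegMap σ₁.toComplex σ₂.toComplex} (hf : IsProjectivity σ₀ σ₁ f)
    (hg : IsProjectivity σ₁ σ₂ g) : IsProjectivity σ₀ σ₂ (g.comp f) := by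
  induction hg with
  | id => exact hf
  | step _ hp ih =>
    have h := IsProjectivity.step ih hp
    exact h

theorem IsPerspectivity.exists_inv {V : Type u} [DecidableEq V]
    {K : AbstractSimplicialComplex V} {k : ℕ} {σ₀ σ₁ : KSimplex K k}
    {f : NondegMap σ₀.toComplex σ₁.toComplex} (hf : IsPerspectivity σ₀ σ₁ f) :
    ∃ g : NondegMap σ₁.toComplex σ₀.toComplex, IsPerspectivity σ₁ σ₀ g ∧
      g.comp f = NondegMap.id _ ∧ f.comp g = NondegMap.id _ := by
  obtain ⟨ρ, h0, h1, hc, hfix⟩ := hf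
  have hinj : Function.Injective f.toFun := by
    intro x y hxy
    exact f.injOn {x, y} (Finset.insert_nonempty x {y}) (by simp) (by simp) hxy
  have hbij : Function.Bijective f.toFun := by
    rw [Fintype.bijective_iff_injective_and_card]
    exact ⟨hinj, by simp [σ₀.card_eq, σ₁.card_eq]⟩
  let e := Equiv.ofBijective f.toFun hbij
  have hl : ∀ x, e.symm (f.toFun x) = x := e.symm_apply_apply
  have hr : ∀ x, f.toFun (e.symm x) = x := e.apply_symm_apply
  refine ⟨⟨e.symm, fun s hs => Finset.Nonempty.image hs _, fun _ _ => e.symm.injective.injOn⟩,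
    ⟨ρ, h1, h0, hc, ?_⟩, ?_, ?_⟩
  · intro x hx
    have h2 : f.toFun ⟨x.1, h0 hx⟩ = x := Subtype.ext (hfix ⟨x.1, h0 hx⟩ hx)
    have h3 := hl ⟨x.1, h0 hx⟩
    rw [h2] at h3
    exact congrArg Subtype.val h3
  · exact NondegMap.ext (funext hl)
  · exact NondegMap.ext (funext hr)

theorem IsProjectivity.exists_inv {V : Type u} [DecidableEq V]
    {K : AbstractSimplicialComplex V} {k : ℕ} {σ₀ σ₁ : KSimplex K k}
    {f : NondegMap σ₀.toComplex σ₁.toComplex} (hf : IsProjectivity σ₀ σ₁ f) :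
    ∃ g : NondegMap σ₁.toComplex σ₀.toComplex, IsProjectivity σ₁ σ₀ g ∧
      g.comp f = NondegMap.id _ ∧ f.comp g = NondegMap.id _ := by
  induction hf with
  | id => exact ⟨NondegMap.id _, .id _, rfl, rfl⟩
  | @step σ₁ σ₂ f p _ hp ih =>
    obtain ⟨g, hg, hgf, hfg⟩ := ih
    obtain ⟨q, hq, hqp, hpq⟩ := hp.exists_inv
    refine ⟨g.comp q, (IsProjectivity.step (.id _) hq).comp hg, ?_, ?_⟩
    · change (g.comp ((q.comp p).comp f)) = _
      rw [hqp]
      exact hgf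
    · change (p.comp ((f.comp g).comp q)) = _
      rw [hfg]
      exact hpq

/-- The projectivities from `σ₀` to `σ₁`. -/
@[ext]
structure Projectivity {V : Type u} [DecidableEq V] {K : AbstractSimplicialComplex V} {k : ℕ}
    (σ₀ σ₁ : KSimplex K k) where
  toMap : NondegMap σ₀.toComplex σ₁.toComplex
  isProjectivity : IsProjectivity σ₀ σ₁ toMap

/-- The `k`-th groupoid of projectivities of `K`: its objects are the `k`-simplices of `K`, its
morphisms are the projectivities. -/
noncomputable instance projectivityGroupoid {V : Type u} [DecidableEq V]
    (K : AbstractSimplicialComplex V) (k : ℕ) : Groupoid (KSimplex K k) where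
  Hom := Projectivity
  id σ := ⟨NondegMap.id _, .id σ⟩
  comp f g := ⟨g.toMap.comp f.toMap, f.isProjectivity.comp g.isProjectivity⟩
  id_comp _ := rfl
  comp_id _ := rfl
  assoc _ _ _ := rfl
  inv f := ⟨f.isProjectivity.exists_inv.choose, f.isProjectivity.exists_inv.choose_spec.1⟩
  inv_comp f := Projectivity.ext f.isProjectivity.exists_inv.choose_spec.2.2
  comp_inv f := Projectivity.ext f.isProjectivity.exists_inv.choose_spec.2.1

/-- The group of projectivities `Π(K, σ)`: the vertex (isotropy) group at `σ` of the groupoid of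
projectivities. -/
abbrev ProjectivityGroup {V : Type u} [DecidableEq V] {K : AbstractSimplicialComplex V} {k : ℕ}
    (σ : KSimplex K k) : Type u := End σ

/-- The map `τ̂ : Hom(σ, L) → Hom(σ, L)` associated with `τ ∈ Π(K, σ)`: on cells, `η ↦ η ∘ τ`. -/
def ProjectivityGroup.hat {V : Type u} {W : Type v} [DecidableEq V] [Fintype W]
    {K : AbstractSimplicialComplex V} {k : ℕ} {σ : KSimplex K k} (τ : ProjectivityGroup σ)
    (L : AbstractSimplicialComplex W) : C(HomComplex σ.toComplex L, HomComplex σ.toComplex L) :=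
  (Projectivity.toMap τ).hat L

end SimplicialHom

namespace SimplicialHom

universe u v w

/-! A perspectivity `p : σ₀ → σ₁` moves at most one vertex, so as maps into `K` the embedding of
`σ₀` and the embedding of `σ₁` composed with `p` agree off a single vertex `v₀`. For such a pair
`f`, `g` and a cell `η`, the function `η ∘ f ∪ η ∘ g` again indexes a cell: a simplex of its join
has at most one vertex over `v₀`, so it lies in the join of `η ∘ f` or in that of `η ∘ g`. Since
that cell is convex and contains both image points, the straight-line homotopy stays in the Hom
complex (`NondegMap.hat_homotopic_of_isCell_union`, `NondegMap.hat_homotopic_of_eq_off_vertex`).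
Chaining these homotopies along a path of simplices, closed at `σ`, gives the theorem. -/

/-- The convex combination `(1 - t) x + t y` of two
points of a geometric simplex. -/
noncomputable def simplexLine {W : Type w} [Fintype W] (t : unitInterval)
    (x y : stdSimplex ℝ W) : stdSimplex ℝ W :=
  ⟨(1 - (t : ℝ)) • x.1 + (t : ℝ) • y.1,
    convex_stdSimplex ℝ W x.2 y.2 (sub_nonneg.2 t.2.2) t.2.1 (by ring)⟩

theorem simplexLine_apply {W : Type w} [Fintype W] (t : unitInterval)
    (x y : stdSimplex ℝ W) (a : W) :
    simplexLine t x y a = (1 - (t : ℝ)) * x a + (t : ℝ) * y a := rfl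

theorem simplexLine_zero {W : Type w} [Fintype W] (x y : stdSimplex ℝ W) :
    simplexLine 0 x y = x :=
  Subtype.ext (by simp [simplexLine])

theorem simplexLine_one {W : Type w} [Fintype W] (x y : stdSimplex ℝ W) :
    simplexLine 1 x y = y :=
  Subtype.ext (by simp [simplexLine])

theorem continuous_simplexLine {W : Type w} [Fintype W] {X : Type*} [TopologicalSpace X]
    {t : X → unitInterval} {f g : X → stdSimplex ℝ W} (ht : Continuous t) (hf : Continuous f)
    (hg : Continuous g) : Continuous fun x => simplexLine (t x) (f x) (g x) := by
  have ht' : Continuous fun x => ((t x : unitInterval) : ℝ) := continuous_subtype_val.comp ht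
  have hf' : Continuous fun x => (f x).1 := continuous_subtype_val.comp hf
  have hg' : Continuous fun x => (g x).1 := continuous_subtype_val.comp hg
  exact Continuous.subtype_mk (((continuous_const.sub ht').smul hf').add (ht'.smul hg')) _

/-- If for each cell `η` of `Hom(K', L)` the cells of `η ∘ f` and `η ∘ g` lie in a common cell
`η ∘ f ∪ η ∘ g` of `Hom(K, L)`, then `f` and `g` induce homotopic maps. -/
theorem NondegMap.hat_homotopic_of_isCell_union {V : Type u} {V' : Type v} {W : Type w}
    [DecidableEq V] [DecidableEq V'] [DecidableEq W] [Fintype W]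
    {K : AbstractSimplicialComplex V} {K' : AbstractSimplicialComplex V'}
    {L : AbstractSimplicialComplex W} (f g : NondegMap K K')
    (h : ∀ η, IsCell K' L η → IsCell K L (fun v => η (f.toFun v) ∪ η (g.toFun v))) :
    ContinuousMap.Homotopic (f.hat L) (g.hat L) := by
  have hc (v : V') : Continuous fun p : unitInterval × HomComplex K' L => p.2.1 v :=
    (continuous_apply v).comp (continuous_subtype_val.comp continuous_snd)
  refine ⟨⟨⟨fun p => ⟨fun v => simplexLine p.1 (p.2.1 (f.toFun v)) (p.2.1 (g.toFun v)), ?_⟩,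
    ?_⟩, ?_, ?_⟩⟩
  -- A point of the segment is supported in the union of the supports of its ends.
  · obtain ⟨η, hη, hx⟩ := p.2.2
    refine ⟨_, h η hη, fun v a ha => ?_⟩
    rw [simplexLine_apply] at ha
    by_contra hn
    rw [Finset.mem_union, not_or] at hn
    have h1 := not_imp_comm.1 (hx (f.toFun v) a) hn.1
    have h2 := not_imp_comm.1 (hx (g.toFun v) a) hn.2
    exact ha (by rw [h1, h2]; ring)
  · exact Continuous.subtype_mk
      (continuous_pi fun v => continuous_simplexLine continuous_fst (hc _) (hc _)) _
  · exact fun x => Subtype.ext (funext fun v => simplexLine_zero _ _)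
  · exact fun x => Subtype.ext (funext fun v => simplexLine_one _ _)

/-- Two non-degenerated maps which agree outside one vertex induce homotopic maps. -/
theorem NondegMap.hat_homotopic_of_eq_off_vertex {V : Type u} {V' : Type v} {W : Type w}
    [DecidableEq V] [DecidableEq V'] [Fintype W]
    {K : AbstractSimplicialComplex V} {K' : AbstractSimplicialComplex V'}
    (L : AbstractSimplicialComplex W) (f g : NondegMap K K') (v₀ : V)
    (hfg : ∀ v, v ≠ v₀ → f.toFun v = g.toFun v) :
    ContinuousMap.Homotopic (f.hat L) (g.hat L) := by
  classical
  refine f.hat_homotopic_of_isCell_union g fun η hη => ⟨fun v => ?_, fun a b hab hK => ?_, ?_⟩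
  · exact (hη.nonempty _).mono Finset.subset_union_left
  · have hf := (hη.comp f).disjoint a b hab hK
    have hg := (hη.comp g).disjoint a b hab hK
    by_cases ha : a = v₀
    · have hb := hfg b fun hb => hab (ha.trans hb.symm)
      simp only [← hb, Finset.union_self, Finset.disjoint_union_left] at hg ⊢
      exact ⟨hf, hg⟩
    · have ha := hfg a ha
      simp only [← ha, Finset.union_self, Finset.disjoint_union_right] at hg ⊢
      exact ⟨hf, hg⟩
  · rintro s hs t ⟨ht, hmem, huniq⟩
    -- The case split decides which join contains `t`. `v₀ ∈ s` is included because `huniq` only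
    -- covers vertices of `s`.
    by_cases h0 : ∃ x ∈ t, v₀ ∈ s ∧ x ∈ η (f.toFun v₀)
    · obtain ⟨x, hx, hv₀, hxv⟩ := h0
      refine (hη.comp f).join_le s hs ⟨ht, fun y hy => ?_, fun v hv y hy z hz hyv hzv =>
        huniq v hv y hy z hz (Finset.mem_union_left _ hyv) (Finset.mem_union_left _ hzv)⟩
      obtain ⟨v, hv, hyv⟩ := hmem y hy
      beta_reduce at hyv
      by_cases hvv : v = v₀
      · subst hvv
        obtain rfl := huniq v hv y hy x hx hyv (Finset.mem_union_left _ hxv)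
        exact ⟨v, hv, hxv⟩
      · rw [← hfg v hvv, Finset.union_self] at hyv
        exact ⟨v, hv, hyv⟩
    -- Any vertex of `t` over `v₀` now comes from `η (g.toFun v₀)`; there may be none.
    · refine (hη.comp g).join_le s hs ⟨ht, fun y hy => ?_, fun v hv y hy z hz hyv hzv =>
        huniq v hv y hy z hz (Finset.mem_union_right _ hyv) (Finset.mem_union_right _ hzv)⟩
      obtain ⟨v, hv, hyv⟩ := hmem y hy
      beta_reduce at hyv
      refine ⟨v, hv, ?_⟩
      by_cases hvv : v = v₀
      · subst hvv
        exact (Finset.mem_union.1 hyv).resolve_left fun h => h0 ⟨y, hy, hv, h⟩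
      · rwa [hfg v hvv, Finset.union_self] at hyv

/-- The embeddings of two `k`-simplices related by a perspectivity induce maps which are homotopic
up to the perspectivity. -/
theorem IsPerspectivity.hat_incl_homotopic {V : Type u} {W : Type v} [DecidableEq V] [Fintype W]
    {K : AbstractSimplicialComplex V} (L : AbstractSimplicialComplex W) {k : ℕ}
    {σ₀ σ₁ : KSimplex K k} {p : NondegMap σ₀.toComplex σ₁.toComplex}
    (hp : IsPerspectivity σ₀ σ₁ p) :
    ContinuousMap.Homotopic (σ₀.incl.hat L) ((p.hat L).comp (σ₁.incl.hat L)) := by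
  obtain ⟨ρ, h0, -, hc, hfix⟩ := hp
  -- The vertex opposite `ρ` is the only one that `p` can move.
  have hcard : (σ₀.verts \ ρ).card = 1 := by
    rw [Finset.card_sdiff_of_subset h0, σ₀.card_eq, hc]
    omega
  obtain ⟨v₀, hv₀⟩ := Finset.card_eq_one.1 hcard
  have hmem : v₀ ∈ σ₀.verts := (Finset.mem_sdiff.1 (hv₀ ▸ Finset.mem_singleton_self v₀)).1
  refine NondegMap.hat_homotopic_of_eq_off_vertex L σ₀.incl (σ₁.incl.comp p) ⟨v₀, hmem⟩
    fun v hv => (hfix v ?_).symm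
  by_contra hvρ
  have h1 : v.1 ∈ σ₀.verts \ ρ := Finset.mem_sdiff.2 ⟨v.2, hvρ⟩
  rw [hv₀, Finset.mem_singleton] at h1
  exact hv (Subtype.ext h1)

/-- The embeddings of two `k`-simplices related by a projectivity induce maps which are homotopic
up to the projectivity. -/
theorem IsProjectivity.hat_incl_homotopic {V : Type u} {W : Type v} [DecidableEq V] [Fintype W]
    {K : AbstractSimplicialComplex V} (L : AbstractSimplicialComplex W) {k : ℕ}
    {σ₀ σ₁ : KSimplex K k} {f : NondegMap σ₀.toComplex σ₁.toComplex}
    (hf : IsProjectivity σ₀ σ₁ f) :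
    ContinuousMap.Homotopic (σ₀.incl.hat L) ((f.hat L).comp (σ₁.incl.hat L)) := by
  induction hf with
  | id => exact ContinuousMap.Homotopic.refl _
  | step _ hp ih =>
    -- `hat` is contravariant by definition, so it suffices to compose the homotopy for the last
    -- perspectivity with the map induced by the path so far.
    exact ih.trans ((ContinuousMap.Homotopic.refl _).comp (hp.hat_incl_homotopic L))

end SimplicialHom

theorem corollary4p9 {V : Type*} {W : Type*} [Finite V] [DecidableEq V] [Fintype W]
    (K : AbstractSimplicialComplex V) (L : AbstractSimplicialComplex W) (k : ℕ)
    (σ : SimplicialHom.KSimplex K k) (τ : SimplicialHom.ProjectivityGroup σ) :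
    ContinuousMap.Homotopic (σ.incl.hat L)
      ((SimplicialHom.ProjectivityGroup.hat τ L).comp (σ.incl.hat L)) :=
  (SimplicialHom.Projectivity.isProjectivity τ).hat_incl_homotopic L
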